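/- For a graph $G$, a geodesic is a shortest path between its end vertices. A set $S\subseteq E(G)$ is an edge general position set of $G$ if no geodesic of $G$ contains three distinct edges of $S$; it is a maximum one (a $\mathrm{gp}_e$-set) if no edge general position set of $G$ has more edges. Let $P_n$ denote the path on $n$ vertices and $\square$ the Cartesian product of graphs. Let $r,s\ge 5$. Then $P_r\,\square\,P_s$ has a unique maximum edge general position set. This set is the set $S$ of semi-boundary edges, that is, of the edges $uv$ of $P_r\,\square\,P_s$ with $\{\deg u,\deg v\}=\{3,4\}$. It has $|S|=2r+2s-8$ edges, and every edge general position set $T\neq S$ of $P_r\,\square\,P_s$ satisfies $|T|<2r+2s-8$. -/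

import Mathlib

namespace SimpleGraph

variable {V : Type*}

/-- A walk is a geodesic if its length is the distance between its end vertices. -/
def Walk.IsGeodesic {G : SimpleGraph V} {u v : V} (p : G.Walk u v) : Prop :=
  p.length = G.dist u v

/-- A finite set `S` of edges of `G` such that no geodesic of `G` contains three (distinct)
edges of `S`. -/
def IsEdgeGeneralPositionSet (G : SimpleGraph V) (S : Finset (Sym2 V)) : Prop :=
  (S : Set (Sym2 V)) ⊆ G.edgeSet ∧
    ∀ (u v : V) (p : G.Walk u v), p.IsGeodesic →
      ¬ ∃ e₁ ∈ S, ∃ e₂ ∈ S, ∃ e₃ ∈ S, e₁ ≠ e₂ ∧ e₁ ≠ e₃ ∧ e₂ ≠ e₃ ∧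
        e₁ ∈ p.edges ∧ e₂ ∈ p.edges ∧ e₃ ∈ p.edges

/-- A `gp_e`-set: an edge general position set of maximum cardinality. -/
def IsGPeSet (G : SimpleGraph V) (S : Finset (Sym2 V)) : Prop :=
  G.IsEdgeGeneralPositionSet S ∧
    ∀ T : Finset (Sym2 V), G.IsEdgeGeneralPositionSet T → T.card ≤ S.card

open Classical in
/-- The edges `uv` of `G` with `{d(u), d(v)} = {3, 4}`. -/
noncomputable def semiBoundaryEdges [Fintype V] (G : SimpleGraph V) : Finset (Sym2 V) :=
  G.edgeFinset.filter fun e => e.map (fun v => G.degree v) = s(3, 4)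

end SimpleGraph

/-! Write `r = m + 1` and `s = n + 1`. A geodesic meets an edge general position set `T` in at most
two edges, and monotone staircase walks are geodesics.

Upper bound: for each `j`, run along the left side, cross row `j`, and continue in the same vertical
direction along the right side. The upward and the downward walk together use row `j` twice and each
edge of both sides once, so 2 (row `j`) + (left + right) ≤ 4. Applying this to three inner rows, and
the bound 2 to the others, gives 2 (inner rows) + 3 (left + right) ≤ 4 (n - 1) (`two_mul_rows_le`).
Adding the analogue for columns yields 2 |T| + (outer cycle) ≤ 4 (m - 1) + 4 (n - 1).

Uniqueness: if |T| ≥ 2 (m - 1) + 2 (n - 1), then `T` avoids the outer cycle and every inner line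
carries exactly two edges. L-shaped geodesics through an inner vertex then force one edge of `T` in
each of the four directions from it (`initial_sums_eq_one`). Hence no edge joins two inner vertices,
and only semi-boundary edges remain.

Attainment: a geodesic is isometric to a segment. So it cannot contain two semi-boundary edges at
the same side, nor visit non-corner vertices of three different sides, since none of these lies
between the other two. -/

namespace SimpleGraph

/-! ### Grid distance and geodesics -/

/-- The grid graph, the Cartesian product of two paths. -/
abbrev grid (r s : ℕ) : SimpleGraph (Fin r × Fin s) := pathGraph r □ pathGraph s

/-- The `ℓ¹` distance between two vertices of the grid. -/
def gridDist {r s : ℕ} (u v : Fin r × Fin s) : ℕ :=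
  ((u.1 : ℕ) - v.1) + ((v.1 : ℕ) - u.1) + (((u.2 : ℕ) - v.2) + ((v.2 : ℕ) - u.2))

variable {r s : ℕ}

lemma grid_adj {u v : Fin r × Fin s} : (grid r s).Adj u v ↔
    (((u.1 : ℕ) + 1 = v.1 ∨ (v.1 : ℕ) + 1 = u.1) ∧ (u.2 : ℕ) = v.2) ∨
    (((u.2 : ℕ) + 1 = v.2 ∨ (v.2 : ℕ) + 1 = u.2) ∧ (u.1 : ℕ) = v.1) := by
  simp only [boxProd_adj, pathGraph_adj, Fin.ext_iff]

lemma gridDist_le_length {u v : Fin r × Fin s} (p : (grid r s).Walk u v) :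
    gridDist u v ≤ p.length := by
  induction p with
  | nil => simp [gridDist]
  | cons h p ih =>
    rw [grid_adj] at h
    simp only [gridDist, Walk.length_cons] at *
    omega

lemma Walk.IsGeodesic.of_length_eq_gridDist {u v : Fin r × Fin s} {p : (grid r s).Walk u v}
    (hp : p.length = gridDist u v) : p.IsGeodesic := by
  obtain ⟨q, hq⟩ := p.reachable.exists_walk_length_eq_dist
  exact le_antisymm (hp ▸ hq ▸ gridDist_le_length q) (dist_le p)

/-- A geodesic repeats no edge, so counting along its edge list counts distinct edges. -/
lemma IsEdgeGeneralPositionSet.countP_le_two {V : Type*} [DecidableEq V] {G : SimpleGraph V}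
    {T : Finset (Sym2 V)} (hT : G.IsEdgeGeneralPositionSet T) {u v : V} {p : G.Walk u v}
    (hp : p.IsGeodesic) : p.edges.countP (· ∈ T) ≤ 2 := by
  have hnodup := (p.isPath_of_length_eq_dist hp).isTrail.edges_nodup
  rw [List.countP_eq_length_filter, ← List.toFinset_card_of_nodup (hnodup.filter _)]
  by_contra! h
  obtain ⟨a, b, c, ha, hb, hc, hab, hac, hbc⟩ := Finset.two_lt_card_iff.1 h
  simp only [List.mem_toFinset, List.mem_filter, decide_eq_true_eq] at ha hb hc
  exact hT.2 u v p hp ⟨a, ha.2, b, hb.2, c, hc.2, hab, hac, hbc, ha.1, hb.1, hc.1⟩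

/-! ### Counting edges along walks in natural coordinates -/

/-- An edge of the grid, with its end vertices regarded as pairs of natural numbers. -/
def natEdge : Sym2 (Fin r × Fin s) → Sym2 (ℕ × ℕ) :=
  Sym2.map (Prod.map Fin.val Fin.val)

lemma natEdge_injective : Function.Injective (natEdge (r := r) (s := s)) :=
  Sym2.map.injective (Fin.val_injective.prodMap Fin.val_injective)

/-- The indicator of the edge from `(i, j)` to `(i + 1, j)`. -/
def horiz (T : Finset (Sym2 (Fin r × Fin s))) (i j : ℕ) : ℕ :=
  if s((i, j), (i + 1, j)) ∈ T.image natEdge then 1 else 0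

/-- The indicator of the edge from `(i, j)` to `(i, j + 1)`. -/
def vert (T : Finset (Sym2 (Fin r × Fin s))) (i j : ℕ) : ℕ :=
  if s((i, j), (i, j + 1)) ∈ T.image natEdge then 1 else 0

/-- There is a walk in the grid from `(a, b)` to `(c, d)` with `n` edges, `w` of them in `T`. -/
def HasWalk (T : Finset (Sym2 (Fin r × Fin s))) (a b c d n w : ℕ) : Prop :=
  ∃ (u v : Fin r × Fin s) (p : (grid r s).Walk u v), (u.1 : ℕ) = a ∧ (u.2 : ℕ) = b ∧
    (v.1 : ℕ) = c ∧ (v.2 : ℕ) = d ∧ p.length = n ∧ p.edges.countP (· ∈ T) = w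

variable {T : Finset (Sym2 (Fin r × Fin s))} {a b c d e f m n w x : ℕ}

lemma HasWalk.append (h₁ : HasWalk T a b c d m w) (h₂ : HasWalk T c d e f n x) :
    HasWalk T a b e f (m + n) (w + x) := by
  obtain ⟨u, v, p, rfl, rfl, hc, hd, rfl, rfl⟩ := h₁
  obtain ⟨v', y, q, hc', hd', rfl, rfl, rfl, rfl⟩ := h₂
  obtain rfl : v = v' := Prod.ext (Fin.ext (by omega)) (Fin.ext (by omega))
  exact ⟨u, y, p.append q, rfl, rfl, rfl, rfl, by simp, by simp [Walk.edges_append]⟩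

lemma HasWalk.reverse (h : HasWalk T a b c d n w) : HasWalk T c d a b n w := by
  obtain ⟨u, v, p, rfl, rfl, rfl, rfl, rfl, rfl⟩ := h
  exact ⟨v, u, p.reverse, rfl, rfl, rfl, rfl, by simp, by simp⟩

lemma HasWalk.nil (ha : a < r) (hb : b < s) : HasWalk T a b a b 0 0 :=
  ⟨(⟨a, ha⟩, ⟨b, hb⟩), _, .nil, rfl, rfl, rfl, rfl, by simp, by simp⟩

lemma HasWalk.single_horiz (ha : a + 1 < r) (hb : b < s) :
    HasWalk T a b (a + 1) b 1 (horiz T a b) := by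
  let u : Fin r × Fin s := (⟨a, by omega⟩, ⟨b, hb⟩)
  let v : Fin r × Fin s := (⟨a + 1, ha⟩, ⟨b, hb⟩)
  have huv : (grid r s).Adj u v := grid_adj.2 (by simp [u, v])
  refine ⟨u, v, huv.toWalk, rfl, rfl, rfl, rfl, by simp, ?_⟩
  have : s((a, b), (a + 1, b)) = natEdge s(u, v) := rfl
  simp [horiz, this, natEdge_injective.mem_finset_image, List.countP_cons, -Finset.mem_image]

lemma HasWalk.single_vert (ha : a < r) (hb : b + 1 < s) :
    HasWalk T a b a (b + 1) 1 (vert T a b) := by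
  let u : Fin r × Fin s := (⟨a, ha⟩, ⟨b, by omega⟩)
  let v : Fin r × Fin s := (⟨a, ha⟩, ⟨b + 1, hb⟩)
  have huv : (grid r s).Adj u v := grid_adj.2 (by simp [u, v])
  refine ⟨u, v, huv.toWalk, rfl, rfl, rfl, rfl, by simp, ?_⟩
  have : s((a, b), (a, b + 1)) = natEdge s(u, v) := rfl
  simp [vert, this, natEdge_injective.mem_finset_image, List.countP_cons, -Finset.mem_image]

lemma HasWalk.row (hac : a ≤ c) (hc : c < r) (hb : b < s) :
    HasWalk T a b c b (c - a) (∑ i ∈ Finset.Ico a c, horiz T i b) := by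
  induction c, hac using Nat.le_induction with
  | base => simpa using HasWalk.nil hc hb
  | succ c hac ih =>
    rw [Finset.sum_Ico_succ_top hac, Nat.succ_sub hac]
    exact (ih (by omega)).append (HasWalk.single_horiz hc hb)

lemma HasWalk.col (hbd : b ≤ d) (ha : a < r) (hd : d < s) :
    HasWalk T a b a d (d - b) (∑ j ∈ Finset.Ico b d, vert T a j) := by
  induction d, hbd using Nat.le_induction with
  | base => simpa using HasWalk.nil ha hd
  | succ d hbd ih =>
    rw [Finset.sum_Ico_succ_top hbd, Nat.succ_sub hbd]
    exact (ih (by omega)).append (HasWalk.single_vert ha hd)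

lemma HasWalk.weight_le_two (hT : (grid r s).IsEdgeGeneralPositionSet T)
    (h : HasWalk T a b c d n w) (hn : n = (a - c) + (c - a) + ((b - d) + (d - b))) : w ≤ 2 := by
  obtain ⟨u, v, p, rfl, rfl, rfl, rfl, rfl, rfl⟩ := h
  exact hT.countP_le_two (.of_length_eq_gridDist hn)

/-! ### The upper bound -/

/-- Adding `hup j` and `hdown j` gives 2 `line j` + ΣA + ΣB ≤ 4. Using this for `j = 1, 2, 3`
produces the coefficient 3; this is where `4 ≤ n` enters. A coefficient above 2 is what later rules
out edges on the outer cycle. -/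
lemma two_mul_sum_add_boundary_le {n : ℕ} (hn : 4 ≤ n) {line A B : ℕ → ℕ}
    (hup : ∀ j ≤ n, ∑ k ∈ Finset.Ico 0 j, A k + line j + ∑ k ∈ Finset.Ico j n, B k ≤ 2)
    (hdown : ∀ j ≤ n, ∑ k ∈ Finset.Ico j n, A k + line j + ∑ k ∈ Finset.Ico 0 j, B k ≤ 2) :
    2 * ∑ j ∈ Finset.Ico 1 n, line j +
      3 * (∑ k ∈ Finset.Ico 0 n, A k + ∑ k ∈ Finset.Ico 0 n, B k) ≤ 4 * (n - 1) := by
  have hrest : ∑ j ∈ Finset.Ico 4 n, line j ≤ 2 * (n - 4) := by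
    have := Finset.sum_le_card_nsmul (Finset.Ico 4 n) line 2 fun j hj => by
      have := hup j (Finset.mem_Ico.1 hj).2.le
      omega
    simpa [mul_comm] using this
  have split (f : ℕ → ℕ) {i : ℕ} (hi : i < 4) :
      ∑ k ∈ Finset.Ico i n, f k = f i + ∑ k ∈ Finset.Ico (i + 1) n, f k :=
    Finset.sum_eq_sum_Ico_succ_bot (by omega) f
  have h1 := hup 1 (by omega)
  have h2 := hup 2 (by omega)
  have h3 := hup 3 (by omega)
  have h1' := hdown 1 (by omega)
  have h2' := hdown 2 (by omega)
  have h3' := hdown 3 (by omega)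
  have e0 := split A (i := 0) (by norm_num)
  have e1 := split A (i := 1) (by norm_num)
  have e2 := split A (i := 2) (by norm_num)
  have f0 := split B (i := 0) (by norm_num)
  have f1 := split B (i := 1) (by norm_num)
  have f2 := split B (i := 2) (by norm_num)
  have g1 := split line (i := 1) (by norm_num)
  have g2 := split line (i := 2) (by norm_num)
  have g3 := split line (i := 3) (by norm_num)
  simp only [Nat.Ico_zero_eq_range, Finset.sum_range_succ, Finset.sum_range_zero,
    Nat.reduceAdd, zero_add] at *
  omega

end SimpleGraph

namespace SimpleGraph

variable {r s : ℕ}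

/-! ### Edge counts by rows and columns -/

lemma exists_natEdge_eq {e : Sym2 (Fin r × Fin s)} (he : e ∈ (grid r s).edgeSet) :
    ∃ i j : ℕ, (i + 1 < r ∧ j < s ∧ natEdge e = s((i, j), (i + 1, j))) ∨
      (i < r ∧ j + 1 < s ∧ natEdge e = s((i, j), (i, j + 1))) := by
  induction e using Sym2.ind with
  | _ u v =>
    obtain ⟨⟨a, ha⟩, b, hb⟩ := u
    obtain ⟨⟨c, hc⟩, d, hd⟩ := v
    rw [mem_edgeSet, grid_adj] at he
    simp only at he
    simp only [natEdge, Sym2.map_mk, Prod.map_apply]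
    obtain ⟨rfl | rfl, rfl⟩ | ⟨rfl | rfl, rfl⟩ := he
    · exact ⟨a, b, .inl ⟨hc, hb, rfl⟩⟩
    · exact ⟨c, b, .inl ⟨ha, hb, Sym2.eq_swap⟩⟩
    · exact ⟨a, b, .inr ⟨ha, hd, rfl⟩⟩
    · exact ⟨a, d, .inr ⟨ha, hb, Sym2.eq_swap⟩⟩

lemma card_eq_sum_horiz_add_sum_vert {m n : ℕ} {T : Finset (Sym2 (Fin (m + 1) × Fin (n + 1)))}
    (hT : (T : Set (Sym2 _)) ⊆ (grid (m + 1) (n + 1)).edgeSet) :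
    T.card = ∑ j ∈ Finset.Ico 0 (n + 1), ∑ i ∈ Finset.Ico 0 m, horiz T i j +
      ∑ i ∈ Finset.Ico 0 (m + 1), ∑ j ∈ Finset.Ico 0 n, vert T i j := by
  classical
  -- Pairs in `A` are (row, position), matching the order of the double sum; hence the swapped
  -- coordinates in `f`.
  let A : Finset (ℕ × ℕ) := {x ∈ Finset.Ico 0 (n + 1) ×ˢ Finset.Ico 0 m |
    s((x.2, x.1), (x.2 + 1, x.1)) ∈ T.image natEdge}
  let B : Finset (ℕ × ℕ) := {x ∈ Finset.Ico 0 (m + 1) ×ˢ Finset.Ico 0 n |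
    s((x.1, x.2), (x.1, x.2 + 1)) ∈ T.image natEdge}
  let f : ℕ × ℕ → Sym2 (ℕ × ℕ) := fun x => s((x.2, x.1), (x.2 + 1, x.1))
  let g : ℕ × ℕ → Sym2 (ℕ × ℕ) := fun x => s((x.1, x.2), (x.1, x.2 + 1))
  have hA : ∑ j ∈ Finset.Ico 0 (n + 1), ∑ i ∈ Finset.Ico 0 m, horiz T i j = A.card := by
    rw [Finset.card_filter, Finset.sum_product]; rfl
  have hB : ∑ i ∈ Finset.Ico 0 (m + 1), ∑ j ∈ Finset.Ico 0 n, vert T i j = B.card := by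
    rw [Finset.card_filter, Finset.sum_product]; rfl
  have hf : Function.Injective f := by
    rintro ⟨a, b⟩ ⟨c, d⟩ h
    simp only [f, Sym2.eq_iff, Prod.mk.injEq] at h ⊢
    omega
  have hg : Function.Injective g := by
    rintro ⟨a, b⟩ ⟨c, d⟩ h
    simp only [g, Sym2.eq_iff, Prod.mk.injEq] at h ⊢
    omega
  have hunion : T.image natEdge = A.image f ∪ B.image g := by
    ext e
    rw [Finset.mem_union, Finset.mem_image (f := f), Finset.mem_image (f := g)]
    constructor
    · intro he
      obtain ⟨e, heT, rfl⟩ := Finset.mem_image.1 he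
      obtain ⟨i, j, ⟨hi, hj, h⟩ | ⟨hi, hj, h⟩⟩ := exists_natEdge_eq (hT heT)
      · refine .inl ⟨(j, i), ?_, h.symm⟩
        rw [h] at he
        exact Finset.mem_filter.2 ⟨by simp; omega, he⟩
      · refine .inr ⟨(i, j), ?_, h.symm⟩
        rw [h] at he
        exact Finset.mem_filter.2 ⟨by simp; omega, he⟩
    · rintro (⟨x, hx, rfl⟩ | ⟨x, hx, rfl⟩)
      exacts [(Finset.mem_filter.1 hx).2, (Finset.mem_filter.1 hx).2]
  have hdisj : Disjoint (A.image f) (B.image g) := by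
    simp only [Finset.disjoint_left, Finset.mem_image]
    rintro _ ⟨⟨a, b⟩, -, rfl⟩ ⟨⟨c, d⟩, -, h⟩
    simp only [f, g, Sym2.eq_iff, Prod.mk.injEq] at h
    omega
  rw [hA, hB, ← Finset.card_image_of_injective T natEdge_injective, hunion,
    Finset.card_union_of_disjoint hdisj, Finset.card_image_of_injective _ hf,
    Finset.card_image_of_injective _ hg]

section Bound

variable {m n : ℕ} {T : Finset (Sym2 (Fin (m + 1) × Fin (n + 1)))}

/-- The walks go from (0, 0) to (m, n) and from (0, n) to (m, 0), crossing along row `j`; both are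
monotone in each coordinate. -/
lemma IsEdgeGeneralPositionSet.two_mul_rows_le
    (hT : (grid (m + 1) (n + 1)).IsEdgeGeneralPositionSet T) (hn : 4 ≤ n) :
    2 * ∑ j ∈ Finset.Ico 1 n, ∑ i ∈ Finset.Ico 0 m, horiz T i j +
      3 * (∑ j ∈ Finset.Ico 0 n, vert T 0 j + ∑ j ∈ Finset.Ico 0 n, vert T m j) ≤
        4 * (n - 1) := by
  refine two_mul_sum_add_boundary_le hn (fun j hj => ?_) (fun j hj => ?_)
  · exact (((HasWalk.col j.zero_le m.succ_pos (by omega)).append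
      (HasWalk.row m.zero_le m.lt_succ_self (by omega))).append
      (HasWalk.col hj m.lt_succ_self (by omega))).weight_le_two hT (by omega)
  · exact (((HasWalk.col hj m.succ_pos (by omega)).reverse.append
      (HasWalk.row m.zero_le m.lt_succ_self (by omega))).append
      (HasWalk.col j.zero_le m.lt_succ_self (by omega)).reverse).weight_le_two hT (by omega)

lemma IsEdgeGeneralPositionSet.two_mul_cols_le
    (hT : (grid (m + 1) (n + 1)).IsEdgeGeneralPositionSet T) (hm : 4 ≤ m) :
    2 * ∑ i ∈ Finset.Ico 1 m, ∑ j ∈ Finset.Ico 0 n, vert T i j +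
      3 * (∑ i ∈ Finset.Ico 0 m, horiz T i 0 + ∑ i ∈ Finset.Ico 0 m, horiz T i n) ≤
        4 * (m - 1) := by
  refine two_mul_sum_add_boundary_le hm (fun i hi => ?_) (fun i hi => ?_)
  · exact (((HasWalk.row i.zero_le (by omega) n.succ_pos).append
      (HasWalk.col n.zero_le (by omega) n.lt_succ_self)).append
      (HasWalk.row hi (by omega) n.lt_succ_self)).weight_le_two hT (by omega)
  · exact (((HasWalk.row hi (by omega) n.succ_pos).reverse.append
      (HasWalk.col n.zero_le (by omega) n.lt_succ_self)).append
      (HasWalk.row i.zero_le (by omega) n.lt_succ_self).reverse).weight_le_two hT (by omega)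

lemma IsEdgeGeneralPositionSet.row_le_two
    (hT : (grid (m + 1) (n + 1)).IsEdgeGeneralPositionSet T) {j : ℕ} (hj : j ≤ n) :
    ∑ i ∈ Finset.Ico 0 m, horiz T i j ≤ 2 :=
  (HasWalk.row m.zero_le m.lt_succ_self (by omega)).weight_le_two hT (by omega)

lemma IsEdgeGeneralPositionSet.col_le_two
    (hT : (grid (m + 1) (n + 1)).IsEdgeGeneralPositionSet T) {i : ℕ} (hi : i ≤ m) :
    ∑ j ∈ Finset.Ico 0 n, vert T i j ≤ 2 :=
  (HasWalk.col n.zero_le (by omega) n.lt_succ_self).weight_le_two hT (by omega)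

lemma sum_Ico_eq_ends_add {k : ℕ} (hk : 1 ≤ k) (f : ℕ → ℕ) :
    ∑ j ∈ Finset.Ico 0 (k + 1), f j = f 0 + f k + ∑ j ∈ Finset.Ico 1 k, f j := by
  rw [Finset.sum_Ico_succ_top k.zero_le, Finset.sum_eq_sum_Ico_succ_bot (by omega)]
  ring

/-- A set in general position has at most `2 (m - 1) + 2 (n - 1)` edges, even if the edges of
the outer cycle are counted with weight `3 / 2`. -/
lemma IsEdgeGeneralPositionSet.two_mul_card_add_boundary_le
    (hT : (grid (m + 1) (n + 1)).IsEdgeGeneralPositionSet T) (hm : 4 ≤ m) (hn : 4 ≤ n) :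
    2 * T.card + (∑ i ∈ Finset.Ico 0 m, horiz T i 0 + ∑ i ∈ Finset.Ico 0 m, horiz T i n +
      ∑ j ∈ Finset.Ico 0 n, vert T 0 j + ∑ j ∈ Finset.Ico 0 n, vert T m j) ≤
        4 * (m - 1) + 4 * (n - 1) := by
  have h₁ := hT.two_mul_rows_le hn
  have h₂ := hT.two_mul_cols_le hm
  -- Doubling the cardinality uses two of the three copies of each outer line; the third is the
  -- extra boundary term.
  rw [card_eq_sum_horiz_add_sum_vert hT.1, sum_Ico_eq_ends_add (by omega),
    sum_Ico_eq_ends_add (by omega)]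
  omega

/-! ### The case of equality -/

lemma eq_two_of_sum_Ico_eq {k : ℕ} {f : ℕ → ℕ} (hf : ∀ j ≤ k, f j ≤ 2)
    (hsum : 2 * (k - 1) ≤ ∑ j ∈ Finset.Ico 1 k, f j) : ∀ j ∈ Finset.Ico 1 k, f j = 2 := by
  have hle : ∀ j ∈ Finset.Ico 1 k, f j ≤ 2 := fun j hj => hf j (Finset.mem_Ico.1 hj).2.le
  refine (Finset.sum_eq_sum_iff_of_le hle).1 (le_antisymm (Finset.sum_le_sum hle) ?_)
  simpa [mul_comm] using hsum

lemma IsEdgeGeneralPositionSet.boundary_eq_zero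
    (hT : (grid (m + 1) (n + 1)).IsEdgeGeneralPositionSet T) (hm : 4 ≤ m) (hn : 4 ≤ n)
    (hcard : 2 * (m - 1) + 2 * (n - 1) ≤ T.card) :
    (∑ i ∈ Finset.Ico 0 m, horiz T i 0 = 0 ∧ ∑ i ∈ Finset.Ico 0 m, horiz T i n = 0) ∧
      ∑ j ∈ Finset.Ico 0 n, vert T 0 j = 0 ∧ ∑ j ∈ Finset.Ico 0 n, vert T m j = 0 := by
  have := hT.two_mul_card_add_boundary_le hm hn
  omega

lemma IsEdgeGeneralPositionSet.lines_eq_two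
    (hT : (grid (m + 1) (n + 1)).IsEdgeGeneralPositionSet T) (hm : 4 ≤ m) (hn : 4 ≤ n)
    (hcard : 2 * (m - 1) + 2 * (n - 1) ≤ T.card) :
    (∀ j ∈ Finset.Ico 1 n, ∑ i ∈ Finset.Ico 0 m, horiz T i j = 2) ∧
      ∀ i ∈ Finset.Ico 1 m, ∑ j ∈ Finset.Ico 0 n, vert T i j = 2 := by
  have h₀ := hT.boundary_eq_zero hm hn hcard
  have h₁ := hT.two_mul_rows_le hn
  have h₂ := hT.two_mul_cols_le hm
  rw [card_eq_sum_horiz_add_sum_vert hT.1, sum_Ico_eq_ends_add (by omega),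
    sum_Ico_eq_ends_add (by omega)] at hcard
  exact ⟨eq_two_of_sum_Ico_eq (fun j hj => hT.row_le_two hj) (by omega),
    eq_two_of_sum_Ico_eq (fun i hi => hT.col_le_two hi) (by omega)⟩

/-- At an inner vertex left + right = up + down = 2, while each of the four L-shaped geodesics has
weight at most 2. The sums for opposite L's add up to 4, so all four are equalities and every arm
has weight 1. -/
lemma IsEdgeGeneralPositionSet.initial_sums_eq_one
    (hT : (grid (m + 1) (n + 1)).IsEdgeGeneralPositionSet T) (hm : 4 ≤ m) (hn : 4 ≤ n)
    (hcard : 2 * (m - 1) + 2 * (n - 1) ≤ T.card) {i j : ℕ} (hi : i ∈ Finset.Ico 1 m)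
    (hj : j ∈ Finset.Ico 1 n) :
    ∑ k ∈ Finset.Ico 0 i, horiz T k j = 1 ∧ ∑ k ∈ Finset.Ico 0 j, vert T i k = 1 := by
  obtain ⟨hrow, hcol⟩ := hT.lines_eq_two hm hn hcard
  replace hrow := hrow j hj
  replace hcol := hcol i hi
  rw [Finset.mem_Ico] at hi hj
  rw [← Finset.sum_Ico_consecutive _ i.zero_le hi.2.le] at hrow
  rw [← Finset.sum_Ico_consecutive _ j.zero_le hj.2.le] at hcol
  have left := HasWalk.row (T := T) (b := j) i.zero_le (by omega) (by omega)
  have right := HasWalk.row (T := T) (b := j) hi.2.le (by omega) (by omega)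
  have down := HasWalk.col (T := T) (a := i) j.zero_le (by omega) (by omega)
  have up := HasWalk.col (T := T) (a := i) hj.2.le (by omega) (by omega)
  have h₁ := (left.append up).weight_le_two hT (by omega)
  have h₂ := (left.append down.reverse).weight_le_two hT (by omega)
  have h₃ := (down.append right).weight_le_two hT (by omega)
  have h₄ := (up.reverse.append right).weight_le_two hT (by omega)
  omega

lemma IsEdgeGeneralPositionSet.of_horiz_eq_one
    (hT : (grid (m + 1) (n + 1)).IsEdgeGeneralPositionSet T) (hm : 4 ≤ m) (hn : 4 ≤ n)
    (hcard : 2 * (m - 1) + 2 * (n - 1) ≤ T.card) {i j : ℕ} (hi : i < m) (hj : j ≤ n)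
    (h : horiz T i j = 1) : (i = 0 ∨ i + 1 = m) ∧ 1 ≤ j ∧ j < n := by
  obtain ⟨⟨hb, ht⟩, -⟩ := hT.boundary_eq_zero hm hn hcard
  rw [Finset.sum_eq_zero_iff] at hb ht
  have hj' : 1 ≤ j ∧ j < n := by
    constructor
    · by_contra! h0
      obtain rfl : j = 0 := by omega
      simp [hb i (by simpa using hi)] at h
    · by_contra! h0
      obtain rfl : j = n := by omega
      simp [ht i (by simpa using hi)] at h
  refine ⟨?_, hj'⟩
  by_contra! hi'
  -- The initial sums up to `i` and `i + 1` are both 1, and they differ by `horiz T i j`.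
  have h₁ := hT.initial_sums_eq_one hm hn hcard (i := i) (by simp; omega) (Finset.mem_Ico.2 hj')
  have h₂ := hT.initial_sums_eq_one hm hn hcard (i := i + 1) (by simp; omega)
    (Finset.mem_Ico.2 hj')
  rw [Finset.sum_Ico_succ_top i.zero_le] at h₂
  omega

lemma IsEdgeGeneralPositionSet.of_vert_eq_one
    (hT : (grid (m + 1) (n + 1)).IsEdgeGeneralPositionSet T) (hm : 4 ≤ m) (hn : 4 ≤ n)
    (hcard : 2 * (m - 1) + 2 * (n - 1) ≤ T.card) {i j : ℕ} (hi : i ≤ m) (hj : j < n)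
    (h : vert T i j = 1) : (j = 0 ∨ j + 1 = n) ∧ 1 ≤ i ∧ i < m := by
  obtain ⟨-, hb, ht⟩ := hT.boundary_eq_zero hm hn hcard
  rw [Finset.sum_eq_zero_iff] at hb ht
  have hi' : 1 ≤ i ∧ i < m := by
    constructor
    · by_contra! h0
      obtain rfl : i = 0 := by omega
      simp [hb j (by simpa using hj)] at h
    · by_contra! h0
      obtain rfl : i = m := by omega
      simp [ht j (by simpa using hj)] at h
  refine ⟨?_, hi'⟩
  by_contra! hj'
  have h₁ := hT.initial_sums_eq_one hm hn hcard (j := j) (Finset.mem_Ico.2 hi') (by simp; omega)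
  have h₂ := hT.initial_sums_eq_one hm hn hcard (j := j + 1) (Finset.mem_Ico.2 hi')
    (by simp; omega)
  rw [Finset.sum_Ico_succ_top j.zero_le] at h₂
  omega

end Bound

end SimpleGraph

namespace SimpleGraph

/-! ### Vertices on geodesics -/

section Geodesic

variable {r s : ℕ}

lemma exists_walk_length_eq_gridDist (u v : Fin r × Fin s) :
    ∃ p : (grid r s).Walk u v, p.length = gridDist u v := by
  -- Only the length matters here, so the weights are taken with respect to the empty set.
  have key (a b c d : ℕ) (ha : a < r) (hb : b < s) (hc : c < r) (hd : d < s) :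
      ∃ w, HasWalk ∅ (r := r) (s := s) a b c d ((a - c) + (c - a) + ((b - d) + (d - b))) w := by
    have hrow : ∃ w, HasWalk ∅ (r := r) (s := s) a b c b ((a - c) + (c - a)) w := by
      rcases le_total a c with h | h
      · exact ⟨_, by simpa [Nat.sub_eq_zero_of_le h] using HasWalk.row (T := ∅) h hc hb⟩
      · exact ⟨_, by simpa [Nat.sub_eq_zero_of_le h] using (HasWalk.row (T := ∅) h ha hb).reverse⟩
    have hcol : ∃ w, HasWalk ∅ (r := r) (s := s) c b c d ((b - d) + (d - b)) w := by
      rcases le_total b d with h | h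
      · exact ⟨_, by simpa [Nat.sub_eq_zero_of_le h] using HasWalk.col (T := ∅) h hc hd⟩
      · exact ⟨_, by simpa [Nat.sub_eq_zero_of_le h] using (HasWalk.col (T := ∅) h hc hb).reverse⟩
    exact ⟨_, hrow.choose_spec.append hcol.choose_spec⟩
  obtain ⟨w, u', v', p, h₁, h₂, h₃, h₄, h, -⟩ :=
    key u.1 u.2 v.1 v.2 u.1.2 u.2.2 v.1.2 v.2.2
  obtain rfl : u' = u := Prod.ext (Fin.ext h₁) (Fin.ext h₂)
  obtain rfl : v' = v := Prod.ext (Fin.ext h₃) (Fin.ext h₄)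
  exact ⟨p, h⟩

lemma Walk.IsGeodesic.length_le_gridDist {u v : Fin r × Fin s} {p : (grid r s).Walk u v}
    (hp : p.IsGeodesic) : p.length ≤ gridDist u v := by
  obtain ⟨q, hq⟩ := exists_walk_length_eq_gridDist u v
  exact hp.trans_le (hq ▸ dist_le q)

lemma gridDist_triangle (u v w : Fin r × Fin s) :
    gridDist u w ≤ gridDist u v + gridDist v w := by
  simp only [gridDist]
  omega

lemma gridDist_comm (u v : Fin r × Fin s) : gridDist u v = gridDist v u := by
  simp only [gridDist]
  omega

/-- The three lengths add up to at most the distance of the ends, which leaves no slack in the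
triangle inequalities. -/
lemma Walk.IsGeodesic.gridDist_append {u v w x : Fin r × Fin s} {p : (grid r s).Walk u w}
    {q : (grid r s).Walk w x} {t : (grid r s).Walk x v} (h : ((p.append q).append t).IsGeodesic) :
    gridDist u x = gridDist u w + gridDist w x := by
  have := h.length_le_gridDist
  have := gridDist_le_length p
  have := gridDist_le_length q
  have := gridDist_le_length t
  have := gridDist_triangle u x v
  have := gridDist_triangle u w x
  simp only [Walk.length_append] at *
  omega

/-- A geodesic of the grid is isometric to a segment, parametrized by the distance to its first
vertex. -/
lemma Walk.IsGeodesic.gridDist_eq {u v w x : Fin r × Fin s} {p : (grid r s).Walk u v}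
    (hp : p.IsGeodesic) (hw : w ∈ p.support) (hx : x ∈ p.support) :
    gridDist u x = gridDist u w + gridDist w x ∨ gridDist u w = gridDist u x + gridDist w x := by
  rw [← p.take_spec hw] at hx hp
  rcases (Walk.mem_support_append_iff _ _).1 hx with h | h
  · rw [← (p.takeUntil w hw).take_spec h] at hp
    exact .inr (gridDist_comm w x ▸ hp.gridDist_append)
  · rw [← (p.dropUntil w hw).take_spec h, Walk.append_assoc] at hp
    exact .inl hp.gridDist_append

/-- Of three vertices on a geodesic, one lies between the other two. -/
lemma Walk.IsGeodesic.gridDist_add {u v a b c : Fin r × Fin s} {p : (grid r s).Walk u v}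
    (hp : p.IsGeodesic) (ha : a ∈ p.support) (hb : b ∈ p.support) (hc : c ∈ p.support) :
    gridDist a c = gridDist a b + gridDist b c ∨ gridDist b c = gridDist a b + gridDist a c ∨
      gridDist a b = gridDist a c + gridDist b c := by
  have := hp.gridDist_eq ha hb
  have := hp.gridDist_eq ha hc
  have := hp.gridDist_eq hb hc
  omega

/-- The four corners of a nondegenerate rectangle of width one do not lie on a geodesic. -/
lemma Walk.IsGeodesic.gridDist_eq_zero {u v a b c d : Fin r × Fin s} {p : (grid r s).Walk u v}
    (hp : p.IsGeodesic) (ha : a ∈ p.support) (hb : b ∈ p.support) (hc : c ∈ p.support)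
    (hd : d ∈ p.support) (hab : gridDist a b = 1) (hcd : gridDist c d = 1)
    (hbd : gridDist b d = gridDist a c) (had : gridDist a d = gridDist a c + 1)
    (hbc : gridDist b c = gridDist a c + 1) : gridDist a c = 0 := by
  -- The distances to `u` place the four corners isometrically on a line, where both diagonals can
  -- exceed the long side by one only if that side is zero.
  have := hp.gridDist_eq ha hb
  have := hp.gridDist_eq ha hc
  have := hp.gridDist_eq ha hd
  have := hp.gridDist_eq hb hc
  have := hp.gridDist_eq hb hd
  have := hp.gridDist_eq hc hd
  omega

end Geodesic

end SimpleGraph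

namespace SimpleGraph

/-! ### Semi-boundary edges -/

open Finset in
lemma degree_pathGraph {k : ℕ} (v : Fin (k + 1)) [Fintype ((pathGraph (k + 1)).neighborSet v)] :
    (pathGraph (k + 1)).degree v =
      (if 0 < (v : ℕ) then 1 else 0) + (if (v : ℕ) < k then 1 else 0) := by
  classical
  have h : (pathGraph (k + 1)).neighborFinset v =
      ((univ : Finset (Fin (k + 1))).filter fun w : Fin (k + 1) => (w : ℕ) + 1 = v) ∪
        (univ : Finset (Fin (k + 1))).filter fun w : Fin (k + 1) => (w : ℕ) = v + 1 := by
    ext w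
    simp only [mem_neighborFinset, pathGraph_adj, mem_union, mem_filter, mem_univ, true_and]
    omega
  rw [← card_neighborFinset_eq_degree, h, card_union_of_disjoint]
  · congr 1
    · split_ifs with hv
      · rw [card_eq_one]
        refine ⟨⟨v - 1, by omega⟩, ?_⟩
        ext w
        simp only [mem_filter, mem_univ, true_and, mem_singleton, Fin.ext_iff]
        omega
      · simp only [card_eq_zero, filter_eq_empty_iff, mem_univ, true_imp_iff]
        omega
    · split_ifs with hv
      · rw [card_eq_one]
        refine ⟨⟨v + 1, by omega⟩, ?_⟩
        ext w
        simp only [mem_filter, mem_univ, true_and, mem_singleton, Fin.ext_iff]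
      · simp only [card_eq_zero, filter_eq_empty_iff, mem_univ, true_imp_iff]
        omega
  · simp only [Finset.disjoint_left, mem_filter, mem_univ, true_and]
    omega

variable {m n : ℕ}

lemma degree_grid (v : Fin (m + 1) × Fin (n + 1))
    [Fintype ((grid (m + 1) (n + 1)).neighborSet v)] :
    (grid (m + 1) (n + 1)).degree v =
      ((if 0 < (v.1 : ℕ) then 1 else 0) + (if (v.1 : ℕ) < m then 1 else 0)) +
        ((if 0 < (v.2 : ℕ) then 1 else 0) + (if (v.2 : ℕ) < n then 1 else 0)) := by
  classical
  rw [degree_boxProd, degree_pathGraph, degree_pathGraph]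

/-- The edge `bc` joins a vertex `b` of side number `t` of the grid, other than a corner, to the
vertex `c` facing it. -/
def IsSideEdge (t : ℕ) (b c : Fin (m + 1) × Fin (n + 1)) : Prop :=
  (((t = 0 ∧ (b.1 : ℕ) = 0 ∧ (c.1 : ℕ) = 1) ∨ (t = 1 ∧ (b.1 : ℕ) = m ∧ (c.1 : ℕ) + 1 = m)) ∧
      (b.2 : ℕ) = c.2 ∧ 0 < (b.2 : ℕ) ∧ (b.2 : ℕ) < n) ∨
    (((t = 2 ∧ (b.2 : ℕ) = 0 ∧ (c.2 : ℕ) = 1) ∨ (t = 3 ∧ (b.2 : ℕ) = n ∧ (c.2 : ℕ) + 1 = n)) ∧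
      (b.1 : ℕ) = c.1 ∧ 0 < (b.1 : ℕ) ∧ (b.1 : ℕ) < m)

lemma exists_isSideEdge_of_degree {u v : Fin (m + 1) × Fin (n + 1)}
    {_ : Fintype ((grid (m + 1) (n + 1)).neighborSet u)}
    {_ : Fintype ((grid (m + 1) (n + 1)).neighborSet v)}
    (hadj : (grid (m + 1) (n + 1)).Adj u v) (hu : (grid (m + 1) (n + 1)).degree u = 3)
    (hv : (grid (m + 1) (n + 1)).degree v = 4) : ∃ t, IsSideEdge t u v := by
  rw [degree_grid] at hu hv
  have hv' : (0 < (v.1 : ℕ) ∧ (v.1 : ℕ) < m) ∧ (0 < (v.2 : ℕ) ∧ (v.2 : ℕ) < n) := by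
    split_ifs at hv <;> omega
  clear hv
  rw [grid_adj] at hadj
  rcases hadj with ⟨h | h, h'⟩ | ⟨h | h, h'⟩
  · refine ⟨0, .inl ⟨.inl ⟨rfl, ?_⟩, ?_⟩⟩ <;> split_ifs at hu <;> omega
  · refine ⟨1, .inl ⟨.inr ⟨rfl, ?_⟩, ?_⟩⟩ <;> split_ifs at hu <;> omega
  · refine ⟨2, .inr ⟨.inl ⟨rfl, ?_⟩, ?_⟩⟩ <;> split_ifs at hu <;> omega
  · refine ⟨3, .inr ⟨.inr ⟨rfl, ?_⟩, ?_⟩⟩ <;> split_ifs at hu <;> omega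

lemma exists_isSideEdge {e : Sym2 (Fin (m + 1) × Fin (n + 1))}
    (he : e ∈ (grid (m + 1) (n + 1)).semiBoundaryEdges) :
    ∃ t b c, e = s(b, c) ∧ IsSideEdge t b c := by
  induction e using Sym2.ind with
  | _ u v =>
    simp only [semiBoundaryEdges, Finset.mem_filter, mem_edgeFinset, mem_edgeSet, Sym2.map_mk,
      Sym2.eq_iff] at he
    obtain ⟨hadj, ⟨hu, hv⟩ | ⟨hu, hv⟩⟩ := he
    · obtain ⟨t, ht⟩ := exists_isSideEdge_of_degree hadj hu hv
      exact ⟨t, u, v, rfl, ht⟩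
    · obtain ⟨t, ht⟩ := exists_isSideEdge_of_degree hadj.symm hv hu
      exact ⟨t, v, u, Sym2.eq_swap, ht⟩

lemma IsSideEdge.mem_semiBoundaryEdges {t : ℕ} {b c : Fin (m + 1) × Fin (n + 1)}
    (h : IsSideEdge t b c) (hm : 3 ≤ m) (hn : 3 ≤ n) :
    s(b, c) ∈ (grid (m + 1) (n + 1)).semiBoundaryEdges := by
  simp only [semiBoundaryEdges, Finset.mem_filter, mem_edgeFinset, mem_edgeSet, Sym2.map_mk,
    Sym2.eq_iff, grid_adj, degree_grid]
  unfold IsSideEdge at h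
  refine ⟨by omega, .inl ⟨?_, ?_⟩⟩
  · split_ifs <;> omega
  · split_ifs <;> omega

/-- Two edges at the same side are opposite unit sides of a rectangle, which `gridDist_eq_zero`
forces to be degenerate. -/
lemma IsSideEdge.eq_of_mem_geodesic {t : ℕ} {a b c d u v : Fin (m + 1) × Fin (n + 1)}
    (hab : IsSideEdge t a b) (hcd : IsSideEdge t c d) {p : (grid (m + 1) (n + 1)).Walk u v}
    (hp : p.IsGeodesic) (h₁ : s(a, b) ∈ p.edges) (h₂ : s(c, d) ∈ p.edges) :
    s(a, b) = s(c, d) := by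
  have h := hp.gridDist_eq_zero (p.fst_mem_support_of_mem_edges h₁)
    (p.snd_mem_support_of_mem_edges h₁) (p.fst_mem_support_of_mem_edges h₂)
    (p.snd_mem_support_of_mem_edges h₂)
  simp only [gridDist] at h
  unfold IsSideEdge at hab hcd
  have hac : ((a.1 : ℕ) = c.1 ∧ (a.2 : ℕ) = c.2) ∧ (b.1 : ℕ) = d.1 ∧ (b.2 : ℕ) = d.2 := by
    rcases hab with ⟨⟨rfl, hab⟩ | ⟨rfl, hab⟩, hab'⟩ | ⟨⟨rfl, hab⟩ | ⟨rfl, hab⟩, hab'⟩ <;>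
    rcases hcd with ⟨⟨ht, hcd⟩ | ⟨ht, hcd⟩, hcd'⟩ | ⟨⟨ht, hcd⟩ | ⟨ht, hcd⟩, hcd'⟩ <;>
    first
    | exact absurd ht (by decide)
    | have := h (by omega) (by omega) (by omega) (by omega) (by omega)
      omega
  rw [show a = c from Prod.ext (Fin.ext hac.1.1) (Fin.ext hac.1.2),
    show b = d from Prod.ext (Fin.ext hac.2.1) (Fin.ext hac.2.2)]

/-- Among vertices of three sides, none lies between the other two. -/
lemma IsSideEdge.gridDist_ne {t₁ t₂ t₃ : ℕ} {a b c a' b' c' : Fin (m + 1) × Fin (n + 1)}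
    (ha : IsSideEdge t₁ a a') (hb : IsSideEdge t₂ b b') (hc : IsSideEdge t₃ c c')
    (h₁₂ : t₁ ≠ t₂) (h₁₃ : t₁ ≠ t₃) (h₂₃ : t₂ ≠ t₃) :
    gridDist a c ≠ gridDist a b + gridDist b c := by
  unfold IsSideEdge at ha hb hc
  intro h
  -- Equality in the `ℓ¹` triangle inequality means betweenness in each coordinate. But `b` is
  -- extreme in one coordinate, and `a` and `c`, being non-corners of other sides, are not extreme
  -- there in the same direction.
  have h' : ((a.1 : ℕ) ≤ b.1 ∧ (b.1 : ℕ) ≤ c.1 ∨ (c.1 : ℕ) ≤ b.1 ∧ (b.1 : ℕ) ≤ a.1) ∧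
      ((a.2 : ℕ) ≤ b.2 ∧ (b.2 : ℕ) ≤ c.2 ∨ (c.2 : ℕ) ≤ b.2 ∧ (b.2 : ℕ) ≤ a.2) := by
    clear ha hb hc
    simp only [gridDist] at h
    omega
  rcases hb with ⟨⟨rfl, hb⟩ | ⟨rfl, hb⟩, hb'⟩ | ⟨⟨rfl, hb⟩ | ⟨rfl, hb⟩, hb'⟩ <;> omega

theorem isEdgeGeneralPositionSet_semiBoundaryEdges :
    (grid (m + 1) (n + 1)).IsEdgeGeneralPositionSet
      (grid (m + 1) (n + 1)).semiBoundaryEdges := by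
  refine ⟨fun e he => ?_, ?_⟩
  · simp only [semiBoundaryEdges, Finset.coe_filter, mem_edgeFinset] at he
    exact he.1
  rintro u v p hp ⟨e₁, he₁, e₂, he₂, e₃, he₃, h₁₂, h₁₃, h₂₃, hp₁, hp₂, hp₃⟩
  obtain ⟨t₁, a, a', rfl, ha⟩ := exists_isSideEdge he₁
  obtain ⟨t₂, b, b', rfl, hb⟩ := exists_isSideEdge he₂
  obtain ⟨t₃, c, c', rfl, hc⟩ := exists_isSideEdge he₃
  have ht₁₂ : t₁ ≠ t₂ := by rintro rfl; exact h₁₂ (ha.eq_of_mem_geodesic hb hp hp₁ hp₂)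
  have ht₁₃ : t₁ ≠ t₃ := by rintro rfl; exact h₁₃ (ha.eq_of_mem_geodesic hc hp hp₁ hp₃)
  have ht₂₃ : t₂ ≠ t₃ := by rintro rfl; exact h₂₃ (hb.eq_of_mem_geodesic hc hp hp₂ hp₃)
  have h₁ := ha.gridDist_ne hb hc ht₁₂ ht₁₃ ht₂₃
  have h₂ := hb.gridDist_ne ha hc ht₁₂.symm ht₂₃ ht₁₃
  have h₃ := ha.gridDist_ne hc hb ht₁₃ ht₁₂ ht₂₃.symm
  rw [gridDist_comm b a] at h₂
  rw [gridDist_comm c b] at h₃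
  rcases hp.gridDist_add (p.fst_mem_support_of_mem_edges hp₁)
    (p.fst_mem_support_of_mem_edges hp₂) (p.fst_mem_support_of_mem_edges hp₃) with h | h | h
  exacts [h₁ h, h₂ h, h₃ h]

lemma horiz_semiBoundaryEdges (hm : 3 ≤ m) (hn : 3 ≤ n) {i j : ℕ} (hi : i < m) (hj : j ≤ n) :
    horiz (grid (m + 1) (n + 1)).semiBoundaryEdges i j =
      if (i = 0 ∨ i + 1 = m) ∧ 1 ≤ j ∧ j < n then 1 else 0 := by
  let u : Fin (m + 1) × Fin (n + 1) := (⟨i, by omega⟩, ⟨j, by omega⟩)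
  let v : Fin (m + 1) × Fin (n + 1) := (⟨i + 1, by omega⟩, ⟨j, by omega⟩)
  have huv : s((i, j), (i + 1, j)) = natEdge s(u, v) := rfl
  rw [horiz]
  refine if_congr ?_ rfl rfl
  rw [huv, natEdge_injective.mem_finset_image]
  constructor
  · intro h
    obtain ⟨t, b, c, he, h⟩ := exists_isSideEdge h
    unfold IsSideEdge at h
    rcases Sym2.eq_iff.1 he with ⟨rfl, rfl⟩ | ⟨rfl, rfl⟩ <;> simp only [u, v] at h <;> omega
  · rintro ⟨h | h, hj'⟩
    · have : IsSideEdge 0 u v := .inl ⟨.inl ⟨rfl, h, congrArg (· + 1) h⟩, rfl, hj'⟩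
      exact this.mem_semiBoundaryEdges hm hn
    · rw [Sym2.eq_swap]
      have : IsSideEdge 1 v u := .inl ⟨.inr ⟨rfl, h, h⟩, rfl, hj'⟩
      exact this.mem_semiBoundaryEdges hm hn

lemma vert_semiBoundaryEdges (hm : 3 ≤ m) (hn : 3 ≤ n) {i j : ℕ} (hi : i ≤ m) (hj : j < n) :
    vert (grid (m + 1) (n + 1)).semiBoundaryEdges i j =
      if (j = 0 ∨ j + 1 = n) ∧ 1 ≤ i ∧ i < m then 1 else 0 := by
  let u : Fin (m + 1) × Fin (n + 1) := (⟨i, by omega⟩, ⟨j, by omega⟩)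
  let v : Fin (m + 1) × Fin (n + 1) := (⟨i, by omega⟩, ⟨j + 1, by omega⟩)
  have huv : s((i, j), (i, j + 1)) = natEdge s(u, v) := rfl
  rw [vert]
  refine if_congr ?_ rfl rfl
  rw [huv, natEdge_injective.mem_finset_image]
  constructor
  · intro h
    obtain ⟨t, b, c, he, h⟩ := exists_isSideEdge h
    unfold IsSideEdge at h
    rcases Sym2.eq_iff.1 he with ⟨rfl, rfl⟩ | ⟨rfl, rfl⟩ <;> simp only [u, v] at h <;> omega
  · rintro ⟨h | h, hi'⟩
    · have : IsSideEdge 2 u v := .inr ⟨.inl ⟨rfl, h, congrArg (· + 1) h⟩, rfl, hi'⟩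
      exact this.mem_semiBoundaryEdges hm hn
    · rw [Sym2.eq_swap]
      have : IsSideEdge 3 v u := .inr ⟨.inr ⟨rfl, h, h⟩, rfl, hi'⟩
      exact this.mem_semiBoundaryEdges hm hn

/-- Serves both directions: `(k, l) = (m, n)` counts horizontal edges and `(n, m)` vertical ones.
The bound `2 ≤ k` keeps the two end positions distinct. -/
lemma sum_sum_ends {k l : ℕ} (hk : 2 ≤ k) (hl : 1 ≤ l) :
    ∑ j ∈ Finset.Ico 0 (l + 1), ∑ i ∈ Finset.Ico 0 k,
      (if (i = 0 ∨ i + 1 = k) ∧ 1 ≤ j ∧ j < l then 1 else 0) = 2 * (l - 1) := by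
  have hinner (j : ℕ) : ∑ i ∈ Finset.Ico 0 k,
      (if (i = 0 ∨ i + 1 = k) ∧ 1 ≤ j ∧ j < l then 1 else 0) =
        if 1 ≤ j ∧ j < l then 2 else 0 := by
    obtain ⟨k, rfl⟩ := Nat.exists_eq_add_of_le' (by omega : 1 ≤ k)
    rw [sum_Ico_eq_ends_add (by omega), Finset.sum_eq_zero]
    · by_cases h : 1 ≤ j ∧ j < l <;> simp [h]
    · intro i hi
      rw [Finset.mem_Ico] at hi
      exact if_neg (by omega)
  rw [Finset.sum_congr rfl fun j _ => hinner j, sum_Ico_eq_ends_add hl,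
    Finset.sum_congr rfl fun j hj => if_pos (Finset.mem_Ico.1 hj)]
  simp [mul_comm]

lemma card_semiBoundaryEdges (hm : 3 ≤ m) (hn : 3 ≤ n) :
    (grid (m + 1) (n + 1)).semiBoundaryEdges.card = 2 * (m - 1) + 2 * (n - 1) := by
  have hrows := sum_sum_ends (k := m) (l := n) (by omega) (by omega)
  have hcols := sum_sum_ends (k := n) (l := m) (by omega) (by omega)
  rw [card_eq_sum_horiz_add_sum_vert isEdgeGeneralPositionSet_semiBoundaryEdges.1, add_comm,
    ← hrows, ← hcols]
  refine congrArg₂ _ ?_ ?_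
  · refine Finset.sum_congr rfl fun i hi => Finset.sum_congr rfl fun j hj => ?_
    rw [Finset.mem_Ico] at hi hj
    exact vert_semiBoundaryEdges hm hn (by omega) (by omega)
  · refine Finset.sum_congr rfl fun j hj => Finset.sum_congr rfl fun i hi => ?_
    rw [Finset.mem_Ico] at hi hj
    exact horiz_semiBoundaryEdges hm hn (by omega) (by omega)

/-! ### Uniqueness -/

lemma IsEdgeGeneralPositionSet.eq_semiBoundaryEdges
    {T : Finset (Sym2 (Fin (m + 1) × Fin (n + 1)))}
    (hT : (grid (m + 1) (n + 1)).IsEdgeGeneralPositionSet T) (hm : 4 ≤ m) (hn : 4 ≤ n)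
    (hcard : 2 * (m - 1) + 2 * (n - 1) ≤ T.card) :
    T = (grid (m + 1) (n + 1)).semiBoundaryEdges := by
  have hm' : 3 ≤ m := by omega
  have hn' : 3 ≤ n := by omega
  -- The cardinality hypothesis reduces equality to one inclusion.
  refine Finset.eq_of_subset_of_card_le (fun e he => ?_)
    (by rwa [card_semiBoundaryEdges hm' hn'])
  have he' := Finset.mem_image_of_mem natEdge he
  rw [← natEdge_injective.mem_finset_image]
  obtain ⟨i, j, ⟨hi, hj, h⟩ | ⟨hi, hj, h⟩⟩ := exists_natEdge_eq (hT.1 he)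
  · rw [h] at he' ⊢
    have h₁ := hT.of_horiz_eq_one hm hn hcard (i := i) (j := j) (by omega) (by omega) (if_pos he')
    by_contra hcon
    have h₂ := horiz_semiBoundaryEdges hm' hn' (i := i) (j := j) (by omega) (by omega)
    rw [horiz, if_neg hcon, if_pos h₁] at h₂
    exact absurd h₂ zero_ne_one
  · rw [h] at he' ⊢
    have h₁ := hT.of_vert_eq_one hm hn hcard (i := i) (j := j) (by omega) (by omega) (if_pos he')
    by_contra hcon
    have h₂ := vert_semiBoundaryEdges hm' hn' (i := i) (j := j) (by omega) (by omega)
    rw [vert, if_neg hcon, if_pos h₁] at h₂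
    exact absurd h₂ zero_ne_one

end SimpleGraph

/-! ### The theorem -/

theorem theorem3p3 (r s : ℕ) (hr : 5 ≤ r) (hs : 5 ≤ s) :
    (∃! S : Finset (Sym2 (Fin r × Fin s)),
      (SimpleGraph.pathGraph r □ SimpleGraph.pathGraph s).IsGPeSet S) ∧
    (SimpleGraph.pathGraph r □ SimpleGraph.pathGraph s).IsGPeSet
      (SimpleGraph.pathGraph r □ SimpleGraph.pathGraph s).semiBoundaryEdges ∧
    (SimpleGraph.pathGraph r □ SimpleGraph.pathGraph s).semiBoundaryEdges.card
      = 2 * r + 2 * s - 8 ∧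
    ∀ T : Finset (Sym2 (Fin r × Fin s)),
      (SimpleGraph.pathGraph r □ SimpleGraph.pathGraph s).IsEdgeGeneralPositionSet T →
      T ≠ (SimpleGraph.pathGraph r □ SimpleGraph.pathGraph s).semiBoundaryEdges →
      T.card < 2 * r + 2 * s - 8 := by
  obtain ⟨m, rfl⟩ := Nat.exists_eq_add_of_le' (by omega : 1 ≤ r)
  obtain ⟨n, rfl⟩ := Nat.exists_eq_add_of_le' (by omega : 1 ≤ s)
  have hcard := SimpleGraph.card_semiBoundaryEdges (m := m) (n := n) (by omega) (by omega)
  have hS := SimpleGraph.isEdgeGeneralPositionSet_semiBoundaryEdges (m := m) (n := n)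
  have hlt : ∀ T : Finset (Sym2 (Fin (m + 1) × Fin (n + 1))),
      (SimpleGraph.grid (m + 1) (n + 1)).IsEdgeGeneralPositionSet T →
      T ≠ (SimpleGraph.grid (m + 1) (n + 1)).semiBoundaryEdges →
      T.card < 2 * (m - 1) + 2 * (n - 1) := fun T hT hne => by
    by_contra! h
    exact hne (hT.eq_semiBoundaryEdges (by omega) (by omega) h)
  have hmax : (SimpleGraph.grid (m + 1) (n + 1)).IsGPeSet
      (SimpleGraph.grid (m + 1) (n + 1)).semiBoundaryEdges := by
    refine ⟨hS, fun T hT => ?_⟩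
    by_cases h : T = (SimpleGraph.grid (m + 1) (n + 1)).semiBoundaryEdges
    · rw [h]
    · exact hcard ▸ (hlt T hT h).le
  refine ⟨⟨_, hmax, fun T hT => ?_⟩, hmax, hcard.trans (by omega), fun T hT hne =>
    (hlt T hT hne).trans_eq (by omega)⟩
  by_contra hne
  exact absurd (hT.2 _ hS) (not_le.2 (hcard ▸ hlt T hT.1 hne))
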